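/- Let $\omega:[0,\infty)\to[0,\infty)$ be a weight function: $\omega$ is continuous, nondecreasing and subadditive, $\omega(0)=0$, $\int_1^\infty \omega(t)t^{-2}\,dt<\infty$ and $\omega(t)/\log(1+t)\to\infty$ as $t\to\infty$. Let $\Omega\subseteq\mathbb R^d$ be open. For $l>0$ let $\|f\|_l^\omega=\int_{\mathbb R^d}|\hat f(\xi)|e^{l\omega(|\xi|)}\,d\xi$. Let $\mathcal D^{(\omega),l}(\Omega)$ be the space of continuous functions $f:\mathbb R^d\to\mathbb C$ with compact support contained in $\Omega$ and $\|f\|_l^\omega<\infty$, and let $\mathcal D^{(\omega)}(\Omega)=\bigcap_{l>0}\mathcal D^{(\omega),l}(\Omega)$. Let $\mathcal E^{(\omega)}(\Omega)$ be the space of smooth functions $f:\Omega\to\mathbb C$ such that $\varphi f\in\mathcal D^{(\omega)}(\Omega)$ for all $\varphi\in\mathcal D^{(\omega)}(\Omega)$; for compact $K\subset\Omega$ and $l>0$ put $$\|f\|_{K,l}^\omega=\inf\{\|\varphi f\|_l^\omega:\ \varphi\in\mathcal D^{(\omega)}(\Omega),\ \varphi=1\text{ on }K\}.$$ A net $(g_\varepsilon)_{\varepsilon\in(0,1)}$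 in $\mathcal E^{(\omega)}(\Omega)$ is moderate if for all compact $K\subset\Omega$ and all $l>0$ there is $k>0$ with $\|g_\varepsilon\|_{K,l}^\omega=o(e^{k\omega(1/\varepsilon)})$ as $\varepsilon\to0$, and negligible if for all compact $K\subset\Omega$, all $l>0$ and all $k>0$, $\|g_\varepsilon\|_{K,l}^\omega=o(e^{-k\omega(1/\varepsilon)})$. Let $\mathcal G^{(\omega)}(\Omega)$ be the quotient of the space of moderate nets by the space of negligible nets. A net $(c_\varepsilon)_{\varepsilon\in(0,1)}$ of complex numbers is negligible if $|c_\varepsilon|=o(e^{-k\omega(1/\varepsilon)})$ for all $k>0$. **Theorem.** Let $h=[(h_\varepsilon)]\in\mathcal G^{(\omega)}(\Omega)$, and suppose that there is $k>0$ such that for every $\rho\in\mathcal D^{(\omega),k}(\Omega)$ the net $\langle h_\varepsilon,\rho\rangle=\int_\Omega h_\varepsilon(x)\rho(x)\,dx$ is negligible. Then $h=0$ in $\mathcal G^{(\omega)}(\Omega)$. -/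

import Mathlib

open MeasureTheory Set Filter Topology
open scoped ENNReal FourierTransform

namespace UltraBeurling

/-- A weight function: a continuous, nondecreasing, subadditive function `ω ≥ 0` on `[0, ∞)` with
`ω 0 = 0`, `∫_1^∞ ω(t) / t² dt < ∞` and `ω(t) / log (1 + t) → ∞`.
Only the values on `[0, ∞)` matter. -/
structure WeightFunction where
  toFun : ℝ → ℝ
  continuousOn' : ContinuousOn toFun (Ici 0)
  monotoneOn' : MonotoneOn toFun (Ici 0)
  map_zero' : toFun 0 = 0
  subadditive' : ∀ x y : ℝ, 0 ≤ x → 0 ≤ y → toFun (x + y) ≤ toFun x + toFun y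
  integrableOn' : IntegrableOn (fun t => toFun t / t ^ 2) (Ici 1)
  tendsto' : Tendsto (fun t => toFun t / Real.log (1 + t)) atTop atTop

instance : CoeFun WeightFunction (fun _ => ℝ → ℝ) := ⟨WeightFunction.toFun⟩

/-- `ℝ^d` with its Euclidean norm. -/
abbrev Space (d : ℕ) := EuclideanSpace ℝ (Fin d)

variable {d : ℕ}

/-! ### Test functions -/

/-- `‖f‖_l^ω = ∫ |f̂(ξ)| e^{l ω(|ξ|)} dξ`, with values in `[0, ∞]`; used for integrable `f`. -/
noncomputable def weightedNorm (ω : WeightFunction) (l : ℝ) (f : Space d → ℂ) : ℝ≥0∞ :=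
  ∫⁻ ξ, ‖𝓕 f ξ‖ₑ * ENNReal.ofReal (Real.exp (l * ω ‖ξ‖))

theorem WeightFunction.nonneg (ω : WeightFunction) {t : ℝ} (ht : 0 ≤ t) : 0 ≤ ω t := by
  rw [← ω.map_zero']
  exact ω.monotoneOn' (mem_Ici.2 le_rfl) (mem_Ici.2 ht) ht

theorem continuous_weight (ω : WeightFunction) (l : ℝ) :
    Continuous fun ξ : Space d => ENNReal.ofReal (Real.exp (l * ω ‖ξ‖)) := by
  have h : Continuous fun ξ : Space d => ω ‖ξ‖ :=
    ω.continuousOn'.comp_continuous continuous_norm (fun x => norm_nonneg x)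
  exact ENNReal.continuous_ofReal.comp (Real.continuous_exp.comp (h.const_mul l))

theorem continuous_fourier {f : Space d → ℂ} (hf : Integrable f) : Continuous (𝓕 f) :=
  VectorFourier.fourierIntegral_continuous (L := innerₗ (Space d)) Real.continuous_fourierChar
    (by exact continuous_inner) hf

theorem fourier_add' {f g : Space d → ℂ} (hf : Integrable f) (hg : Integrable g) (ξ : Space d) :
    𝓕 (f + g) ξ = 𝓕 f ξ + 𝓕 g ξ :=
  congrFun (VectorFourier.fourierIntegral_add (L := innerₗ (Space d)) Real.continuous_fourierChar
    (by exact continuous_inner) hf hg) ξ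

theorem fourier_smul' (c : ℂ) (f : Space d → ℂ) (ξ : Space d) :
    𝓕 (c • f) ξ = c * 𝓕 f ξ :=
  congrFun (VectorFourier.fourierIntegral_const_smul Real.fourierChar volume _ f c) ξ

theorem weightedNorm_add_le (ω : WeightFunction) (l : ℝ) {f g : Space d → ℂ}
    (hf : Integrable f) (hg : Integrable g) :
    weightedNorm ω l (f + g) ≤ weightedNorm ω l f + weightedNorm ω l g := by
  unfold weightedNorm
  rw [← lintegral_add_left]
  · refine lintegral_mono fun ξ => ?_
    rw [← add_mul, fourier_add' hf hg]
    gcongr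
    exact enorm_add_le _ _
  · exact ((continuous_fourier hf).enorm.measurable).mul (continuous_weight ω l).measurable

theorem weightedNorm_smul (ω : WeightFunction) (l : ℝ) (c : ℂ) (f : Space d → ℂ) :
    weightedNorm ω l (c • f) = ‖c‖ₑ * weightedNorm ω l f := by
  unfold weightedNorm
  rw [← lintegral_const_mul' _ _ enorm_ne_top]
  simp_rw [fourier_smul', enorm_mul, mul_assoc]

theorem integrable_fourier (ω : WeightFunction) {l : ℝ} (hl : 0 ≤ l) {f : Space d → ℂ}
    (hf : Integrable f) (hfn : weightedNorm ω l f < ⊤) : Integrable (𝓕 f) := by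
  refine ⟨(continuous_fourier hf).aestronglyMeasurable, lt_of_le_of_lt ?_ hfn⟩
  refine lintegral_mono fun ξ => ?_
  refine le_mul_of_one_le_right' ?_
  rw [← ENNReal.ofReal_one]
  exact ENNReal.ofReal_le_ofReal (Real.one_le_exp (mul_nonneg hl (ω.nonneg (norm_nonneg _))))

theorem weight_le_mul (ω : WeightFunction) {l : ℝ} (hl : 0 ≤ l) (ξ t : Space d) :
    ENNReal.ofReal (Real.exp (l * ω ‖ξ‖)) ≤
      ENNReal.ofReal (Real.exp (l * ω ‖t‖)) * ENNReal.ofReal (Real.exp (l * ω ‖ξ - t‖)) := by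
  rw [← ENNReal.ofReal_mul (Real.exp_nonneg _), ← Real.exp_add, ← mul_add]
  refine ENNReal.ofReal_le_ofReal (Real.exp_le_exp.2 (mul_le_mul_of_nonneg_left ?_ hl))
  refine le_trans ?_ (ω.subadditive' _ _ (norm_nonneg t) (norm_nonneg (ξ - t)))
  refine ω.monotoneOn' (mem_Ici.2 (norm_nonneg _))
    (mem_Ici.2 (add_nonneg (norm_nonneg _) (norm_nonneg _))) ?_
  simpa using norm_add_le t (ξ - t)

theorem fourier_mul_eq {u v : Space d → ℂ} (hu : Continuous u) (hv : Continuous v)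
    (hui : Integrable u) (hvi : Integrable v) (huv : Integrable (u * v))
    (hU : Integrable (𝓕 u)) (hV : Integrable (𝓕 v)) :
    𝓕 (u * v) = MeasureTheory.convolution (𝓕 u) (𝓕 v) (ContinuousLinearMap.mul ℂ ℂ) volume := by
  set F := MeasureTheory.convolution (𝓕 u) (𝓕 v) (ContinuousLinearMap.mul ℂ ℂ) volume with hF
  have h1 : 𝓕⁻ F = u * v := by
    ext x
    rw [Real.fourierInv_eq_fourier_neg, hF, Real.fourier_mul_convolution_eq hU hV,
      ← Real.fourierInv_eq_fourier_neg, ← Real.fourierInv_eq_fourier_neg,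
      hu.fourierInv_fourier_eq hui hU, hv.fourierInv_fourier_eq hvi hV, Pi.mul_apply]
  have hc : Continuous F := by
    refine BddAbove.continuous_convolution_right_of_integrable _ ?_ hU (continuous_fourier hvi)
    refine ⟨∫ x, ‖v x‖, ?_⟩
    rintro _ ⟨ξ, rfl⟩
    exact VectorFourier.norm_fourierIntegral_le_integral_norm _ _ _ _ _
  have hFi : Integrable F := hU.integrable_convolution _ hV
  have hF0 : F = 𝓕⁻ (𝓕 F) := (hc.fourierInv_fourier_eq hFi (by
    have h2 : 𝓕 F = fun x => (u * v) (-x) := by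
      ext x
      rw [← h1, Real.fourierInv_eq_fourier_neg, neg_neg]
    rw [h2]
    exact huv.comp_neg)).symm
  rw [hF0, ← Real.fourierInv_comm, h1]

theorem weightedNorm_mul_le (ω : WeightFunction) {l : ℝ} (hl : 0 ≤ l) {u v : Space d → ℂ}
    (hu : Continuous u) (hv : Continuous v) (hui : Integrable u) (hvi : Integrable v)
    (huv : Integrable (u * v)) (hun : weightedNorm ω l u < ⊤) (hvn : weightedNorm ω l v < ⊤) :
    weightedNorm ω l (u * v) ≤ weightedNorm ω l u * weightedNorm ω l v := by
  have hU := integrable_fourier ω hl hui hun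
  have hV := integrable_fourier ω hl hvi hvn
  have hUm : Measurable fun t : Space d => ‖𝓕 u t‖ₑ * ENNReal.ofReal (Real.exp (l * ω ‖t‖)) :=
    (continuous_fourier hui).enorm.measurable.mul (continuous_weight ω l).measurable
  have hVm : Measurable fun t : Space d => ‖𝓕 v t‖ₑ * ENNReal.ofReal (Real.exp (l * ω ‖t‖)) :=
    (continuous_fourier hvi).enorm.measurable.mul (continuous_weight ω l).measurable
  calc weightedNorm ω l (u * v)
      ≤ ∫⁻ ξ : Space d, ∫⁻ t : Space d,
          (‖𝓕 u t‖ₑ * ENNReal.ofReal (Real.exp (l * ω ‖t‖))) *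
            (‖𝓕 v (ξ - t)‖ₑ * ENNReal.ofReal (Real.exp (l * ω ‖ξ - t‖))) := by
        refine lintegral_mono fun ξ => ?_
        rw [fourier_mul_eq hu hv hui hvi huv hU hV, convolution_def]
        refine (mul_le_mul_left (enorm_integral_le_lintegral_enorm _) _).trans ?_
        rw [← lintegral_mul_const' _ _ ENNReal.ofReal_ne_top]
        refine lintegral_mono fun t => ?_
        rw [ContinuousLinearMap.mul_apply', enorm_mul]
        refine (mul_le_mul_right (weight_le_mul ω hl ξ t) _).trans (le_of_eq ?_)
        ring
    _ = ∫⁻ t : Space d, ∫⁻ ξ : Space d,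
          (‖𝓕 u t‖ₑ * ENNReal.ofReal (Real.exp (l * ω ‖t‖))) *
            (‖𝓕 v (ξ - t)‖ₑ * ENNReal.ofReal (Real.exp (l * ω ‖ξ - t‖))) := by
        refine lintegral_lintegral_swap ?_
        exact ((hUm.comp measurable_snd).mul
          (hVm.comp (measurable_fst.sub measurable_snd))).aemeasurable
    _ = weightedNorm ω l u * weightedNorm ω l v := by
        have h (t : Space d) : (∫⁻ ξ : Space d,
            (‖𝓕 u t‖ₑ * ENNReal.ofReal (Real.exp (l * ω ‖t‖))) *
              (‖𝓕 v (ξ - t)‖ₑ * ENNReal.ofReal (Real.exp (l * ω ‖ξ - t‖)))) =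
            (‖𝓕 u t‖ₑ * ENNReal.ofReal (Real.exp (l * ω ‖t‖))) * weightedNorm ω l v := by
          have hm : Measurable fun ξ : Space d =>
              ‖𝓕 v (ξ - t)‖ₑ * ENNReal.ofReal (Real.exp (l * ω ‖ξ - t‖)) :=
            hVm.comp (measurable_id.sub_const t)
          rw [lintegral_const_mul _ hm, weightedNorm]
          congr 1
          exact lintegral_sub_right_eq_self
            (fun ξ => ‖𝓕 v ξ‖ₑ * ENNReal.ofReal (Real.exp (l * ω ‖ξ‖))) t
        simp_rw [h]
        rw [lintegral_mul_const _ hUm]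
        rfl

/-- `𝒟^{(ω),l}(Ω)`: the functions with compact support in `Ω` and finite norm of index `l`. -/
noncomputable def testSpaceAt (ω : WeightFunction) (l : ℝ) (Ω : Set (Space d)) :
    Submodule ℂ (Space d → ℂ) where
  carrier := {f | Continuous f ∧ HasCompactSupport f ∧ tsupport f ⊆ Ω ∧ weightedNorm ω l f < ⊤}
  zero_mem' := by
    refine ⟨continuous_zero, HasCompactSupport.zero, ?_, ?_⟩
    · rw [tsupport_eq_empty_iff.2 rfl]; exact empty_subset _
    · have := weightedNorm_smul ω l 0 (0 : Space d → ℂ)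
      rw [zero_smul, enorm_zero, zero_mul] at this
      rw [this]
      exact ENNReal.zero_lt_top
  add_mem' := by
    rintro f g ⟨hf, hfc, hfs, hfn⟩ ⟨hg, hgc, hgs, hgn⟩
    refine ⟨hf.add hg, hfc.add hgc, (tsupport_add f g).trans (union_subset hfs hgs), ?_⟩
    exact (weightedNorm_add_le ω l (hf.integrable_of_hasCompactSupport hfc)
      (hg.integrable_of_hasCompactSupport hgc)).trans_lt (ENNReal.add_lt_top.2 ⟨hfn, hgn⟩)
  smul_mem' := by
    rintro c f ⟨hf, hfc, hfs, hfn⟩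
    refine ⟨hf.const_smul c, hfc.mono (Function.support_const_smul_subset c f),
      (closure_mono (Function.support_const_smul_subset c f)).trans hfs, ?_⟩
    rw [weightedNorm_smul]
    exact ENNReal.mul_lt_top enorm_lt_top hfn

/-- `𝒟^{(ω)}(Ω)`, the Beurling test functions: all norms of index `l > 0` are finite. -/
noncomputable def testSpace (ω : WeightFunction) (Ω : Set (Space d)) :
    Submodule ℂ (Space d → ℂ) :=
  ⨅ (l : ℝ) (_ : 0 < l), testSpaceAt ω l Ω

theorem mem_testSpace {ω : WeightFunction} {Ω : Set (Space d)} {f : Space d → ℂ} :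
    f ∈ testSpace ω Ω ↔ ∀ l : ℝ, 0 < l → f ∈ testSpaceAt ω l Ω := by
  simp [testSpace, Submodule.mem_iInf]

/-! ### Ultradifferentiable functions -/

/-- `ℰ^{(ω)}(Ω)`: smooth functions `f` on `Ω` such that `φ f` is a test function for every test
function `φ`.  The values of `f` outside `Ω` play no role (since `φ` vanishes there). -/
noncomputable def ultraSpace (ω : WeightFunction) (Ω : Set (Space d)) :
    Submodule ℂ (Space d → ℂ) where
  carrier := {f | ContDiffOn ℝ ((⊤ : ℕ∞) : WithTop ℕ∞) f Ω ∧ ∀ φ ∈ testSpace ω Ω, φ * f ∈ testSpace ω Ω}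
  zero_mem' := ⟨contDiffOn_const, fun φ _ => by rw [mul_zero]; exact zero_mem _⟩
  add_mem' := by
    rintro f g ⟨hf, hf'⟩ ⟨hg, hg'⟩
    exact ⟨hf.add hg, fun φ hφ => by rw [mul_add]; exact add_mem (hf' φ hφ) (hg' φ hφ)⟩
  smul_mem' := by
    rintro c f ⟨hf, hf'⟩
    exact ⟨hf.const_smul c, fun φ hφ => by
      rw [mul_smul_comm]; exact Submodule.smul_mem _ c (hf' φ hφ)⟩

noncomputable instance (ω : WeightFunction) (Ω : Set (Space d)) :
    AddCommGroup (ultraSpace ω Ω) :=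
  Submodule.addCommGroup _

/-- `‖f‖_{K,l}^ω`: the infimum of `‖φ f‖_l^ω` over the test functions `φ` on `Ω` that are equal
to `1` on `K`. -/
noncomputable def localNorm (ω : WeightFunction) (Ω K : Set (Space d)) (l : ℝ)
    (f : Space d → ℂ) : ℝ≥0∞ :=
  ⨅ φ ∈ {φ : Space d → ℂ | φ ∈ testSpace ω Ω ∧ ∀ x ∈ K, φ x = 1}, weightedNorm ω l (φ * f)

/-- Adding two functions, with one cut-off `ψ` and a larger compact set. -/
theorem localNorm_add_le (ω : WeightFunction) {Ω K : Set (Space d)} {l : ℝ} (hl : 0 < l)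
    {ψ : Space d → ℂ} (hψ : ψ ∈ testSpace ω Ω) (hψK : ∀ x ∈ K, ψ x = 1)
    {f g : Space d → ℂ} (hf : f ∈ ultraSpace ω Ω) (hg : g ∈ ultraSpace ω Ω) :
    localNorm ω Ω K l (f + g) ≤
      (weightedNorm ω l ψ + 1) * (localNorm ω Ω (tsupport ψ) l f + localNorm ω Ω (tsupport ψ) l g) := by
  have hi {φ : Space d → ℂ} (hφ : φ ∈ testSpace ω Ω) : Integrable φ :=
    let h := mem_testSpace.1 hφ l hl
    h.1.integrable_of_hasCompactSupport h.2.1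
  have key {f : Space d → ℂ} (hf : f ∈ ultraSpace ω Ω) :
      weightedNorm ω l (ψ * f) ≤ (weightedNorm ω l ψ + 1) * localNorm ω Ω (tsupport ψ) l f := by
    have hψl := mem_testSpace.1 hψ l hl
    have hψf := hf.2 ψ hψ
    have hle (φ : Space d → ℂ) (hφ : φ ∈ testSpace ω Ω) (h1 : ∀ x ∈ tsupport ψ, φ x = 1) :
        weightedNorm ω l (ψ * f) ≤ weightedNorm ω l ψ * weightedNorm ω l (φ * f) := by
      have he : ψ * f = ψ * (φ * f) := by
        ext x
        by_cases hx : x ∈ tsupport ψ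
        · simp [h1 x hx]
        · simp [image_eq_zero_of_notMem_tsupport hx]
      have hφf := hf.2 φ hφ
      have hφl := mem_testSpace.1 hφf l hl
      have hpi := hi hψf
      rw [he] at hpi ⊢
      exact weightedNorm_mul_le ω hl.le hψl.1 hφl.1 (hi hψ) (hi hφf) hpi hψl.2.2.2 hφl.2.2.2
    unfold localNorm
    have h0 : weightedNorm ω l ψ + 1 ≠ 0 := by simp
    have ht : weightedNorm ω l ψ + 1 ≠ ⊤ := (ENNReal.add_lt_top.2 ⟨hψl.2.2.2, by simp⟩).ne
    simp_rw [ENNReal.mul_iInf_of_ne h0 ht]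
    refine le_iInf₂ fun φ hφ => (hle φ hφ.1 hφ.2).trans ?_
    gcongr
    exact le_self_add
  calc localNorm ω Ω K l (f + g) ≤ weightedNorm ω l (ψ * (f + g)) := iInf₂_le ψ ⟨hψ, hψK⟩
    _ ≤ weightedNorm ω l (ψ * f) + weightedNorm ω l (ψ * g) := by
      rw [mul_add]
      exact weightedNorm_add_le ω l (hi (hf.2 ψ hψ)) (hi (hg.2 ψ hψ))
    _ ≤ _ := by
      rw [mul_add]
      exact add_le_add (key hf) (key hg)

/-! ### Nets and asymptotic conditions -/

/-- The parameter `ε ∈ (0, 1)`. -/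
abbrev NetIndex := Ioo (0 : ℝ) 1

/-- The filter `ε → 0`. -/
def toZero : Filter NetIndex := comap Subtype.val (𝓝 (0 : ℝ))

/-- `u_ε = o(e^{k ω(1/ε)})` as `ε → 0`, for a net in `[0, ∞]`. -/
def IsLittleOExp (ω : WeightFunction) (k : ℝ) (u : NetIndex → ℝ≥0∞) : Prop :=
  Tendsto (fun ε : NetIndex => u ε / ENNReal.ofReal (Real.exp (k * ω (1 / (ε : ℝ)))))
    toZero (𝓝 0)

/-- Moderate nets in `ℰ^{(ω)}(Ω)`. -/
def IsModerate (ω : WeightFunction) (Ω : Set (Space d)) (g : NetIndex → ultraSpace ω Ω) : Prop :=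
  ∀ K : Set (Space d), IsCompact K → K ⊆ Ω → ∀ h : ℝ, 0 < h → ∃ k : ℝ, 0 < k ∧
    IsLittleOExp ω k fun ε => localNorm ω Ω K h (g ε)

/-- Negligible nets in `ℰ^{(ω)}(Ω)`. -/
def IsNegligible (ω : WeightFunction) (Ω : Set (Space d)) (g : NetIndex → ultraSpace ω Ω) : Prop :=
  ∀ K : Set (Space d), IsCompact K → K ⊆ Ω → ∀ h : ℝ, 0 < h → ∀ k : ℝ, 0 < k →
    IsLittleOExp ω (-k) fun ε => localNorm ω Ω K h (g ε)

/-- `c_ε = o(e^{-k ω(1/ε)})` for all `k > 0`: the nets of complex numbers that represent `0` in the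
ring of `(ω)`-generalized constants. -/
def IsNegligibleConst (ω : WeightFunction) (c : NetIndex → ℂ) : Prop :=
  ∀ k : ℝ, 0 < k → IsLittleOExp ω (-k) fun ε => ‖c ε‖ₑ

instance : toZero.NeBot := by
  unfold toZero
  rw [comap_neBot_iff_frequently, Subtype.range_coe]
  have h : 𝓝[>] (0 : ℝ) ≤ 𝓝 0 := nhdsWithin_le_nhds
  exact (Frequently.filter_mono (Eventually.frequently (Ioo_mem_nhdsGT one_pos)) h)

theorem IsLittleOExp.mono {ω : WeightFunction} {k k' : ℝ} {u v : NetIndex → ℝ≥0∞}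
    (hu : IsLittleOExp ω k u) (hvu : ∀ ε, v ε ≤ u ε) (hk : k ≤ k') : IsLittleOExp ω k' v := by
  refine tendsto_of_tendsto_of_tendsto_of_le_of_le tendsto_const_nhds hu (fun _ => zero_le)
    fun ε => ENNReal.div_le_div (hvu ε) (ENNReal.ofReal_le_ofReal (Real.exp_le_exp.2 ?_))
  exact mul_le_mul_of_nonneg_right hk (ω.nonneg (one_div_nonneg.2 ε.2.1.le))

theorem IsLittleOExp.add {ω : WeightFunction} {k : ℝ} {u v : NetIndex → ℝ≥0∞}
    (hu : IsLittleOExp ω k u) (hv : IsLittleOExp ω k v) :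
    IsLittleOExp ω k fun ε => u ε + v ε := by
  have h := Tendsto.add hu hv
  rw [add_zero] at h
  simpa only [IsLittleOExp, ENNReal.add_div] using h

theorem IsLittleOExp.const_mul {ω : WeightFunction} {k : ℝ} {u : NetIndex → ℝ≥0∞} {C : ℝ≥0∞}
    (hC : C ≠ ⊤) (hu : IsLittleOExp ω k u) : IsLittleOExp ω k fun ε => C * u ε := by
  have h := ENNReal.Tendsto.const_mul hu (Or.inr hC)
  rw [mul_zero] at h
  simpa only [IsLittleOExp, mul_div_assoc] using h

theorem IsLittleOExp.exists_cutoff {ω : WeightFunction} {Ω K : Set (Space d)} {k l : ℝ}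
    {f : NetIndex → Space d → ℂ} (h : IsLittleOExp ω k fun ε => localNorm ω Ω K l (f ε)) :
    ∃ ψ ∈ testSpace ω Ω, ∀ x ∈ K, ψ x = 1 := by
  obtain ⟨ε, hε⟩ := (h.eventually (gt_mem_nhds ENNReal.zero_lt_top)).exists
  by_contra! hne
  have : localNorm ω Ω K l (f ε) = ⊤ := by
    refine iInf₂_eq_top.2 fun φ hφ => ?_
    obtain ⟨x, hx, hx'⟩ := hne φ hφ.1
    exact absurd (hφ.2 x hx) hx'
  simp only [this] at hε
  rw [ENNReal.top_div_of_ne_top ENNReal.ofReal_ne_top] at hε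
  exact lt_irrefl _ hε

theorem localNorm_smul_le (ω : WeightFunction) (Ω K : Set (Space d)) (l : ℝ) {c : ℂ} (hc : c ≠ 0)
    (f : Space d → ℂ) : localNorm ω Ω K l (c • f) ≤ ‖c‖ₑ * localNorm ω Ω K l f := by
  unfold localNorm
  simp_rw [ENNReal.mul_iInf_of_ne (enorm_ne_zero.2 hc) enorm_ne_top]
  refine iInf₂_mono fun φ _ => ?_
  rw [mul_smul_comm, weightedNorm_smul]

theorem tsupport_subset {ω : WeightFunction} {Ω : Set (Space d)} {ψ : Space d → ℂ}
    (hψ : ψ ∈ testSpace ω Ω) : IsCompact (tsupport ψ) ∧ tsupport ψ ⊆ Ω :=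
  let h := mem_testSpace.1 hψ 1 one_pos
  ⟨h.2.1, h.2.2.1⟩

theorem IsModerate.add {ω : WeightFunction} {Ω : Set (Space d)} {f g : NetIndex → ultraSpace ω Ω}
    (hf : IsModerate ω Ω f) (hg : IsModerate ω Ω g) : IsModerate ω Ω (f + g) := by
  intro K hK hKΩ h hh
  obtain ⟨_, _, hk⟩ := hf K hK hKΩ h hh
  obtain ⟨ψ, hψ, hψK⟩ := hk.exists_cutoff
  obtain ⟨hS, hSΩ⟩ := tsupport_subset hψ
  obtain ⟨k₁, hk₁, h₁⟩ := hf _ hS hSΩ h hh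
  obtain ⟨k₂, hk₂, h₂⟩ := hg _ hS hSΩ h hh
  refine ⟨max k₁ k₂, lt_max_of_lt_left hk₁, ?_⟩
  exact (((h₁.mono (fun _ => le_rfl) (le_max_left _ _)).add
    (h₂.mono (fun _ => le_rfl) (le_max_right _ _))).const_mul
      (ENNReal.add_lt_top.2 ⟨(mem_testSpace.1 hψ h hh).2.2.2, ENNReal.one_lt_top⟩).ne).mono
      (fun ε => localNorm_add_le ω hh hψ hψK (f ε).2 (g ε).2) le_rfl

theorem IsNegligible.add {ω : WeightFunction} {Ω : Set (Space d)}
    {f g : NetIndex → ultraSpace ω Ω}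
    (hf : IsNegligible ω Ω f) (hg : IsNegligible ω Ω g) : IsNegligible ω Ω (f + g) := by
  intro K hK hKΩ h hh k hk
  obtain ⟨ψ, hψ, hψK⟩ := (hf K hK hKΩ h hh k hk).exists_cutoff
  obtain ⟨hS, hSΩ⟩ := tsupport_subset hψ
  exact (((hf _ hS hSΩ h hh k hk).add (hg _ hS hSΩ h hh k hk)).const_mul
      (ENNReal.add_lt_top.2 ⟨(mem_testSpace.1 hψ h hh).2.2.2, ENNReal.one_lt_top⟩).ne).mono
      (fun ε => localNorm_add_le ω hh hψ hψK (f ε).2 (g ε).2) le_rfl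

/-! ### The algebra of generalized functions -/

/-- `ℰ_M^{(ω)}(Ω)`, the space of moderate nets.  (The zero net is moderate, because there are
cut-off functions in `𝒟^{(ω)}(Ω)`; it is listed explicitly only so that this existence theorem
is not needed for the definition.) -/
noncomputable def moderateNets (ω : WeightFunction) (Ω : Set (Space d)) :
    Submodule ℂ (NetIndex → ultraSpace ω Ω) where
  carrier := {g | IsModerate ω Ω g ∨ g = 0}
  zero_mem' := Or.inr rfl
  add_mem' := by
    rintro f g (hf | rfl) (hg | rfl)
    · exact Or.inl (hf.add hg)
    · exact Or.inl (by rwa [add_zero])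
    · exact Or.inl (by rwa [zero_add])
    · exact Or.inr (add_zero 0)
  smul_mem' := by
    rintro c f (hf | rfl)
    · rcases eq_or_ne c 0 with rfl | hc
      · exact Or.inr (zero_smul ℂ f)
      · refine Or.inl fun K hK hKΩ h hh => ?_
        obtain ⟨k, hk, hk'⟩ := hf K hK hKΩ h hh
        exact ⟨k, hk, (hk'.const_mul enorm_ne_top).mono
          (fun ε => localNorm_smul_le ω Ω K h hc (f ε)) le_rfl⟩
    · exact Or.inr (smul_zero c)

/-- `𝒩^{(ω)}(Ω)`, the space of negligible nets (the zero net is listed as in `moderateNets`). -/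
noncomputable def negligibleNets (ω : WeightFunction) (Ω : Set (Space d)) :
    Submodule ℂ (NetIndex → ultraSpace ω Ω) where
  carrier := {g | IsNegligible ω Ω g ∨ g = 0}
  zero_mem' := Or.inr rfl
  add_mem' := by
    rintro f g (hf | rfl) (hg | rfl)
    · exact Or.inl (hf.add hg)
    · exact Or.inl (by rwa [add_zero])
    · exact Or.inl (by rwa [zero_add])
    · exact Or.inr (add_zero 0)
  smul_mem' := by
    rintro c f (hf | rfl)
    · rcases eq_or_ne c 0 with rfl | hc
      · exact Or.inr (zero_smul ℂ f)
      · exact Or.inl fun K hK hKΩ h hh k hk => ((hf K hK hKΩ h hh k hk).const_mul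
          enorm_ne_top).mono (fun ε => localNorm_smul_le ω Ω K h hc (f ε)) le_rfl
    · exact Or.inr (smul_zero c)

noncomputable instance (ω : WeightFunction) (Ω : Set (Space d)) :
    AddCommGroup (moderateNets ω Ω) :=
  Submodule.addCommGroup _

/-- `𝒢^{(ω)}(Ω) = ℰ_M^{(ω)}(Ω) / 𝒩^{(ω)}(Ω)`. -/
abbrev GenFun (ω : WeightFunction) (Ω : Set (Space d)) :=
  moderateNets ω Ω ⧸ (negligibleNets ω Ω).submoduleOf (moderateNets ω Ω)

/-- The class `[(g_ε)]` of a moderate net. -/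
noncomputable def GenFun.mk {ω : WeightFunction} {Ω : Set (Space d)} (g : moderateNets ω Ω) :
    GenFun ω Ω :=
  Submodule.Quotient.mk g

/-- The pairing `⟨f, ρ⟩ = ∫_Ω f(x) ρ(x) dx`. -/
noncomputable def pairing (Ω : Set (Space d)) (f ρ : Space d → ℂ) : ℂ :=
  ∫ x in Ω, f x * ρ x

end UltraBeurling

/-! Fix a cut-off `ψ` and put `F_ε = 𝓕 (ψ * g ε)`. For frequencies `ξ_j` and `a ∈ ℓ¹`, the function
`ρ_a = ψ · ∑ a_j e^{-kω(|ξ_j|)} e^{-2πi⟨x, ξ_j⟩}` lies in `𝒟^{(ω),k}(Ω)`, and `⟨g_ε, ρ_a⟩ = ∑ a_j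
e^{-kω(|ξ_j|)} F_ε(ξ_j)`. Pairing with these `ρ_a` thus gives functionals on `ℓ¹`, and
Banach–Steinhaus there turns the hypothesis, which concerns each `ρ` separately, into a bound
uniform in `ξ` (`exists_fourier_bound`): `|F_ε(ξ)| ≤ C e^{kω(|ξ|)} e^{-Mω(1/ε)}` for small `ε`, with
`M` arbitrary and the loss `k` independent of `M`.

To estimate `∫ |F_ε| e^{lω}`, split at `ω(|ξ|) = R ω(1/ε)` (`weightedNorm_le_of_fourier_bound`).
Below the threshold the uniform bound suffices once `M` is large compared with `R`. Above it, the
norm of index `l + 1` gains a factor `e^{-Rω(1/ε)}`, which beats the moderate growth of that norm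
once `R` is large. -/

namespace UltraBeurling

/-! ### Uniform boundedness on `ℓ¹` -/

/-- The uniform boundedness principle for functionals on `ℓ¹` given by bounded sequences. -/
theorem exists_bound_of_pointwise_bounded_tsum {c : ℕ → ℕ → ℂ} {B : ℕ → ℝ}
    (hB : ∀ n j, ‖c n j‖ ≤ B n)
    (h : ∀ a : ℕ → ℂ, (Summable fun j => ‖a j‖) → ∃ M, ∀ n, ‖∑' j, a j * c n j‖ ≤ M) :
    ∃ M, ∀ n j, ‖c n j‖ ≤ M := by
  have hs (a : lp (fun _ : ℕ => ℂ) 1) : Summable fun j => ‖a j‖ := by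
    simpa using (memℓp_gen_iff (by simp)).1 (lp.memℓp a)
  have hn (a : lp (fun _ : ℕ => ℂ) 1) : ‖a‖ = ∑' j, ‖a j‖ := by
    simpa using lp.norm_eq_tsum_rpow (by simp) a
  have hle (n : ℕ) (a : lp (fun _ : ℕ => ℂ) 1) (j : ℕ) : ‖a j * c n j‖ ≤ ‖a j‖ * B n := by
    rw [norm_mul]
    exact mul_le_mul_of_nonneg_left (hB n j) (norm_nonneg _)
  have hsc (n : ℕ) (a : lp (fun _ : ℕ => ℂ) 1) : Summable fun j => a j * c n j :=
    Summable.of_norm_bounded ((hs a).mul_right (B n)) (hle n a)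
  -- `B n` may depend on `n`: it only makes each functional continuous. The uniformity in `n` comes
  -- from Banach–Steinhaus.
  let T (n : ℕ) : lp (fun _ : ℕ => ℂ) 1 →L[ℂ] ℂ :=
    LinearMap.mkContinuous
      { toFun := fun a => ∑' j, a j * c n j
        map_add' := fun a b => by
          rw [← (hsc n a).tsum_add (hsc n b)]
          simp [add_mul]
        map_smul' := fun r a => by
          simp [mul_assoc, tsum_mul_left] }
      (B n) fun a => by
        rw [hn, mul_comm, ← tsum_mul_right]
        exact tsum_of_norm_bounded ((hs a).mul_right (B n)).hasSum (hle n a)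
  have hT (n : ℕ) (a : lp (fun _ : ℕ => ℂ) 1) : T n a = ∑' j, a j * c n j := rfl
  obtain ⟨M, hM⟩ := banach_steinhaus (g := T) fun a => h a (hs a)
  refine ⟨M, fun n j => ?_⟩
  -- Evaluation at the unit vectors of `ℓ¹` recovers the single entries `c n j`.
  have h1 := (T n).le_of_opNorm_le (hM n) (lp.single 1 j (1 : ℂ))
  rw [lp.norm_single zero_lt_one, norm_one, mul_one, hT, tsum_eq_single j] at h1
  · simpa using h1
  · intro i hi
    simp [hi]

/-! ### Test functions built from trigonometric series -/

variable {d : ℕ}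

/-- The trigonometric series `∑ b_j e^{-2πi⟨x, ξ_j⟩}`. -/
noncomputable def trigSeries (b : ℕ → ℂ) (ξ : ℕ → Space d) (x : Space d) : ℂ :=
  ∑' j, b j * (Real.fourierChar (-inner ℝ x (ξ j)) : ℂ)

theorem continuous_trigSeries {b : ℕ → ℂ} (hb : Summable fun j => ‖b j‖) (ξ : ℕ → Space d) :
    Continuous (trigSeries b ξ) := by
  refine continuous_tsum (fun j => ?_) hb fun j x => ?_
  · have := Real.continuous_fourierChar
    fun_prop
  · rw [norm_mul, Circle.norm_coe, mul_one]

/-- Each exponential translates `𝓕 f`; absolute summability of `b` allows the sum and the integral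
to be exchanged. -/
theorem fourier_mul_trigSeries {f : Space d → ℂ} (hf : Integrable f) {b : ℕ → ℂ}
    (hb : Summable fun j => ‖b j‖) (ξ : ℕ → Space d) (η : Space d) :
    𝓕 (f * trigSeries b ξ) η = ∑' j, b j * 𝓕 f (η + ξ j) := by
  have hi (j : ℕ) : Integrable fun x => b j * (Real.fourierChar (-inner ℝ x (η + ξ j)) • f x) :=
    ((Real.fourierIntegral_convergent_iff (η + ξ j)).2 hf).const_mul _
  have hn (j : ℕ) (x : Space d) :
      ‖b j * (Real.fourierChar (-inner ℝ x (η + ξ j)) • f x)‖ = ‖b j‖ * ‖f x‖ := by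
    simp
  have hs := hasSum_integral_of_summable_integral_norm hi (by
    simp_rw [hn, integral_const_mul]
    exact hb.mul_right _)
  simp_rw [Real.fourier_eq, ← integral_const_mul]
  rw [hs.tsum_eq]
  congr 1 with x
  rw [Pi.mul_apply, trigSeries, Circle.smul_def, smul_eq_mul, ← mul_assoc, ← tsum_mul_left]
  congr 1 with j
  rw [inner_add_right, neg_add, AddChar.map_add_eq_mul, Circle.smul_def, smul_eq_mul,
    Circle.coe_mul]
  ring

/-- By subadditivity of `ω`, a translation by `ξ` costs at most the factor `e^{lω(|ξ|)}`. -/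
theorem lintegral_fourier_add_le (ω : WeightFunction) {l : ℝ} (hl : 0 ≤ l) {f : Space d → ℂ}
    (hf : Integrable f) (ξ : Space d) :
    ∫⁻ η, ‖𝓕 f (η + ξ)‖ₑ * ENNReal.ofReal (Real.exp (l * ω ‖η‖)) ≤
      ENNReal.ofReal (Real.exp (l * ω ‖ξ‖)) * weightedNorm ω l f := by
  have hm : Measurable fun η : Space d =>
      ‖𝓕 f (η + ξ)‖ₑ * ENNReal.ofReal (Real.exp (l * ω ‖η + ξ‖)) :=
    (((continuous_fourier hf).enorm.measurable).mul (continuous_weight ω l).measurable).comp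
      (measurable_id.add_const ξ)
  have he : weightedNorm ω l f =
      ∫⁻ η, ‖𝓕 f (η + ξ)‖ₑ * ENNReal.ofReal (Real.exp (l * ω ‖η + ξ‖)) :=
    (lintegral_add_right_eq_self
      (fun η => ‖𝓕 f η‖ₑ * ENNReal.ofReal (Real.exp (l * ω ‖η‖))) ξ).symm
  rw [he, ← lintegral_const_mul _ hm]
  refine lintegral_mono fun η => ?_
  have h := weight_le_mul ω hl η (-ξ)
  rw [norm_neg, sub_neg_eq_add] at h
  refine (mul_le_mul_right h _).trans (le_of_eq ?_)
  ring

/-- The damping factors `e^{-lω(|ξ_j|)}` cancel exactly the cost of the translations by `ξ_j`, so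
that the norm is at most `‖a‖_{ℓ¹} ‖f‖_l`, whatever the frequencies are. -/
theorem weightedNorm_mul_trigSeries_lt_top (ω : WeightFunction) {l : ℝ} (hl : 0 ≤ l)
    {f : Space d → ℂ} (hf : Integrable f) (hfn : weightedNorm ω l f < ⊤) {a : ℕ → ℂ}
    (ha : Summable fun j => ‖a j‖) (ξ : ℕ → Space d)
    (hb : Summable fun j => ‖a j * Real.exp (-(l * ω ‖ξ j‖))‖) :
    weightedNorm ω l (f * trigSeries (fun j => a j * Real.exp (-(l * ω ‖ξ j‖))) ξ) < ⊤ := by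
  set b : ℕ → ℂ := fun j => a j * Real.exp (-(l * ω ‖ξ j‖)) with hbdef
  have hbe (j : ℕ) : ‖b j‖ₑ * ENNReal.ofReal (Real.exp (l * ω ‖ξ j‖)) = ‖a j‖ₑ := by
    rw [hbdef, enorm_mul, ← ofReal_norm (Complex.ofReal _), Complex.norm_real,
      Real.norm_of_nonneg (Real.exp_nonneg _), mul_assoc,
      ← ENNReal.ofReal_mul (Real.exp_nonneg _), ← Real.exp_add]
    simp
  have hm (j : ℕ) : Measurable fun η : Space d =>
      ‖𝓕 f (η + ξ j)‖ₑ * ENNReal.ofReal (Real.exp (l * ω ‖η‖)) :=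
    (((continuous_fourier hf).enorm.measurable).comp (measurable_id.add_const (ξ j))).mul
      (continuous_weight ω l).measurable
  calc weightedNorm ω l (f * trigSeries b ξ)
      ≤ ∫⁻ η, ∑' j, ‖b j‖ₑ *
          (‖𝓕 f (η + ξ j)‖ₑ * ENNReal.ofReal (Real.exp (l * ω ‖η‖))) := by
        refine lintegral_mono fun η => ?_
        rw [fourier_mul_trigSeries hf hb]
        refine (mul_le_mul_left enorm_tsum_le_tsum_enorm _).trans (le_of_eq ?_)
        rw [← ENNReal.tsum_mul_right]
        exact tsum_congr fun j => by rw [enorm_mul, mul_assoc]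
    _ = ∑' j, ‖b j‖ₑ *
          ∫⁻ η, ‖𝓕 f (η + ξ j)‖ₑ * ENNReal.ofReal (Real.exp (l * ω ‖η‖)) := by
        rw [lintegral_tsum fun j => ((hm j).const_mul _).aemeasurable]
        simp_rw [lintegral_const_mul _ (hm _)]
    _ ≤ ∑' j, ‖a j‖ₑ * weightedNorm ω l f := by
        refine ENNReal.tsum_le_tsum fun j => ?_
        rw [← hbe, mul_assoc]
        exact mul_le_mul_right (lintegral_fourier_add_le ω hl hf (ξ j)) _
    _ < ⊤ := by
        rw [ENNReal.tsum_mul_right]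
        refine ENNReal.mul_lt_top (lt_top_iff_ne_top.2 ?_) hfn
        exact ENNReal.tsum_coe_ne_top_iff_summable.2 (NNReal.summable_coe.1 ha)

theorem summable_norm_mul_exp_neg (ω : WeightFunction) {l : ℝ} (hl : 0 ≤ l) {a : ℕ → ℂ}
    (ha : Summable fun j => ‖a j‖) (ξ : ℕ → Space d) :
    Summable fun j => ‖a j * Real.exp (-(l * ω ‖ξ j‖))‖ := by
  refine ha.of_nonneg_of_le (fun _ => norm_nonneg _) fun j => ?_
  rw [norm_mul, Complex.norm_real, Real.norm_of_nonneg (Real.exp_nonneg _)]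
  refine mul_le_of_le_one_right (norm_nonneg _) (Real.exp_le_one_iff.2 ?_)
  exact neg_nonpos.2 (mul_nonneg hl (ω.nonneg (norm_nonneg _)))

theorem mul_trigSeries_mem_testSpaceAt (ω : WeightFunction) {l : ℝ} (hl : 0 ≤ l)
    {Ω : Set (Space d)} {ψ : Space d → ℂ} (hψ : ψ ∈ testSpaceAt ω l Ω) {a : ℕ → ℂ}
    (ha : Summable fun j => ‖a j‖) (ξ : ℕ → Space d) :
    ψ * trigSeries (fun j => a j * Real.exp (-(l * ω ‖ξ j‖))) ξ ∈ testSpaceAt ω l Ω := by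
  obtain ⟨hc, hs, hΩ, hn⟩ := hψ
  have hb := summable_norm_mul_exp_neg ω hl ha ξ
  exact ⟨hc.mul (continuous_trigSeries hb ξ), hs.mul_right,
    (tsupport_mul_subset_left).trans hΩ,
    weightedNorm_mul_trigSeries_lt_top ω hl (hc.integrable_of_hasCompactSupport hs) hn ha ξ hb⟩

/-- The pairing is the Fourier transform of `ψ * f * trigSeries b ξ` at the origin. -/
theorem pairing_mul_trigSeries {Ω : Set (Space d)} {f ψ : Space d → ℂ}
    (hψ : tsupport ψ ⊆ Ω) (hi : Integrable (ψ * f)) {b : ℕ → ℂ}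
    (hb : Summable fun j => ‖b j‖) (ξ : ℕ → Space d) :
    pairing Ω f (ψ * trigSeries b ξ) = ∑' j, b j * 𝓕 (ψ * f) (ξ j) := by
  have h := fourier_mul_trigSeries hi hb ξ 0
  simp_rw [zero_add] at h
  rw [← h, pairing, setIntegral_eq_integral_of_forall_compl_eq_zero, Real.fourier_eq]
  · congr 1 with x
    simp
    ring
  · intro x hx
    simp [image_eq_zero_of_notMem_tsupport fun hx' => hx (hψ hx')]

/-! ### The uniform bound on the Fourier transforms -/

theorem IsNegligibleConst.tendsto {ω : WeightFunction} {c : NetIndex → ℂ}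
    (hc : IsNegligibleConst ω c) {m : ℝ} (hm : 0 < m) :
    Tendsto (fun ε : NetIndex => Real.exp (m * ω (1 / (ε : ℝ))) * ‖c ε‖) toZero (𝓝 0) := by
  have h := (ENNReal.tendsto_toReal ENNReal.zero_ne_top).comp (hc m hm)
  refine h.congr fun ε => ?_
  rw [Function.comp_apply, ENNReal.toReal_div, ENNReal.toReal_ofReal (Real.exp_nonneg _),
    toReal_enorm, neg_mul, Real.exp_neg, div_inv_eq_mul, mul_comm]

/-- Allows a failure of the bound to be witnessed along a sequence `ε_n → 0`, which then also fixes
a countable set of frequencies. -/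
instance : toZero.IsCountablyGenerated := by
  unfold toZero
  infer_instance

/-- If `⟨g_ε, ρ⟩` is negligible for all `ρ ∈ 𝒟^{(ω),k}(Ω)`, then the Fourier transforms of `ψ g_ε`
are `O(e^{k ω(|ξ|) - m ω(1/ε)})`, uniformly in `ξ`. -/
theorem exists_fourier_bound (ω : WeightFunction) {Ω : Set (Space d)} {k : ℝ} (hk : 0 ≤ k)
    {g : NetIndex → Space d → ℂ}
    (hyp : ∀ ρ ∈ testSpaceAt ω k Ω, IsNegligibleConst ω fun ε => pairing Ω (g ε) ρ)
    {ψ : Space d → ℂ} (hψ : ψ ∈ testSpaceAt ω k Ω) (hi : ∀ ε, Integrable (ψ * g ε))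
    {m : ℝ} (hm : 0 < m) :
    ∃ C : ℝ, ∀ᶠ ε in toZero, ∀ ξ,
      ‖𝓕 (ψ * g ε) ξ‖ ≤ C * (Real.exp (k * ω ‖ξ‖) * Real.exp (-(m * ω (1 / (ε : ℝ))))) := by
  by_contra! hcon
  -- Were there no such `C`, then each `C = n` would fail at some `ε_n → 0` and some `ξ_n`. These
  -- `ξ_n` serve as the frequencies of the trigonometric series.
  obtain ⟨s, hs⟩ := toZero.exists_antitone_basis
  have hex (n : ℕ) : ∃ ε ∈ s n, ∃ ξ,
      (n : ℝ) * (Real.exp (k * ω ‖ξ‖) * Real.exp (-(m * ω (1 / (ε : ℝ))))) <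
        ‖𝓕 (ψ * g ε) ξ‖ := by
    obtain ⟨ε, h1, h2⟩ := ((hcon n).and_eventually (hs.1.mem_of_mem trivial)).exists
    exact ⟨ε, h2, h1⟩
  choose e he ξ hξ using hex
  have hnorm (r : ℝ) : ‖((Real.exp r : ℝ) : ℂ)‖ = Real.exp r := by
    rw [Complex.norm_real, Real.norm_of_nonneg (Real.exp_nonneg _)]
  obtain ⟨M, hM⟩ := exists_bound_of_pointwise_bounded_tsum
    (c := fun n j => ((Real.exp (m * ω (1 / (e n : ℝ))) : ℝ) : ℂ) *
      ((Real.exp (-(k * ω ‖ξ j‖)) : ℝ) * 𝓕 (ψ * g (e n)) (ξ j)))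
    (B := fun n => Real.exp (m * ω (1 / (e n : ℝ))) * ∫ x, ‖(ψ * g (e n)) x‖) (by
      intro n j
      rw [norm_mul, hnorm, norm_mul, hnorm]
      refine mul_le_mul_of_nonneg_left ?_ (Real.exp_nonneg _)
      refine (mul_le_of_le_one_left (norm_nonneg _) (Real.exp_le_one_iff.2 ?_)).trans
        (VectorFourier.norm_fourierIntegral_le_integral_norm _ _ _ _ _)
      exact neg_nonpos.2 (mul_nonneg hk (ω.nonneg (norm_nonneg _)))) (by
      intro a ha
      have ht := ((hyp _ (mul_trigSeries_mem_testSpaceAt ω hk hψ ha ξ)).tendsto hm).comp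
        (hs.tendsto he)
      -- Of the convergence to `0` along `ε_n`, only boundedness is needed.
      obtain ⟨M, hM⟩ := ht.bddAbove_range
      refine ⟨M, fun n => le_trans (le_of_eq ?_) (hM ⟨n, rfl⟩)⟩
      rw [Function.comp_apply, pairing_mul_trigSeries hψ.2.2.1 (hi _)
        (summable_norm_mul_exp_neg ω hk ha ξ)]
      nth_rw 2 [← hnorm (m * _)]
      rw [← norm_mul, ← tsum_mul_left]
      congr 2 with j
      ring)
  obtain ⟨n, hn⟩ := exists_nat_ge M
  have h1 := hξ n
  -- The diagonal entry is larger than `n` by the choice of `ε_n` and `ξ_n`, hence larger than `M`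
  -- for this `n`.
  have h2 := (hM n n).trans hn
  rw [norm_mul, hnorm, norm_mul, hnorm, Real.exp_neg] at h2
  rw [Real.exp_neg] at h1
  have hA := Real.exp_pos (m * ω (1 / (e n : ℝ)))
  have hB := Real.exp_pos (k * ω ‖ξ n‖)
  refine absurd h1 (not_lt.2 ?_)
  rw [← div_eq_mul_inv, ← mul_div_assoc, le_div_iff₀ hA]
  rw [← mul_assoc, mul_comm (Real.exp _), mul_assoc, inv_mul_le_iff₀ hB] at h2
  linarith

/-! ### Growth of the weight and splitting of the frequencies -/

theorem WeightFunction.eventually_log_le (ω : WeightFunction) :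
    ∀ᶠ t : ℝ in atTop, Real.log (1 + t) ≤ ω t := by
  filter_upwards [ω.tendsto'.eventually_ge_atTop 1, eventually_gt_atTop 0] with t h1 h2
  exact (one_le_div₀ (Real.log_pos (by linarith))).1 h1

theorem WeightFunction.tendsto_atTop (ω : WeightFunction) : Tendsto ω atTop atTop :=
  tendsto_atTop_mono' atTop ω.eventually_log_le
    (Real.tendsto_log_atTop.comp (tendsto_atTop_add_const_left _ _ tendsto_id))

theorem tendsto_weight_one_div (ω : WeightFunction) :
    Tendsto (fun ε : NetIndex => ω (1 / (ε : ℝ))) toZero atTop := by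
  refine ω.tendsto_atTop.comp ?_
  simp_rw [one_div]
  refine tendsto_inv_nhdsGT_zero.comp (tendsto_nhdsWithin_iff.2 ⟨tendsto_comap, ?_⟩)
  exact Eventually.of_forall fun ε => ε.2.1

theorem exists_lintegral_exp_neg_lt_top (d : ℕ) (ω : WeightFunction) :
    ∃ s : ℝ, 0 ≤ s ∧
      ∫⁻ ξ : Space d, ENNReal.ofReal (Real.exp (-(s * ω ‖ξ‖))) < ⊤ := by
  obtain ⟨T, hT⟩ := eventually_atTop.1 ω.eventually_log_le
  -- Since `ω(t) ≥ log (1 + t)` for large `t`, the integrand is dominated by a multiple of `(1 +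
  -- |ξ|)^{-(d+1)}`, which is integrable on `ℝ^d`.
  refine ⟨d + 1, by positivity, ?_⟩
  have hfin : ∫⁻ ξ : Space d, ENNReal.ofReal ((1 + ‖ξ‖) ^ (-((d : ℝ) + 1))) < ⊤ :=
    finite_integral_one_add_norm (by simp)
  refine lt_of_le_of_lt ?_ (ENNReal.mul_lt_top (ENNReal.ofReal_lt_top
    (r := Real.exp ((d + 1) * Real.log (1 + max T 0)))) hfin)
  rw [← lintegral_const_mul' _ _ ENNReal.ofReal_ne_top]
  refine lintegral_mono fun ξ => ?_
  rw [← ENNReal.ofReal_mul (Real.exp_nonneg _)]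
  refine ENNReal.ofReal_le_ofReal ?_
  have h1 : 0 < 1 + ‖ξ‖ := by positivity
  rw [Real.rpow_def_of_pos h1, ← Real.exp_add, Real.exp_le_exp]
  -- The added constant takes care of `|ξ| ≤ T`, where `ω` may lie below the logarithm.
  have h2 : Real.log (1 + ‖ξ‖) ≤ ω ‖ξ‖ + Real.log (1 + max T 0) := by
    have h3 : 0 ≤ Real.log (1 + max T 0) := Real.log_nonneg (by simp)
    rcases le_total T ‖ξ‖ with h | h
    · linarith [hT _ h]
    · have := Real.log_le_log h1 (add_le_add_right (h.trans (le_max_left T 0)) 1)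
      linarith [ω.nonneg (norm_nonneg ξ)]
  nlinarith [mul_le_mul_of_nonneg_left h2 (by positivity : (0 : ℝ) ≤ d + 1)]

/-- `‖ψ f‖_l ≤ (‖ψ‖_l + 1) ‖f‖_{supp ψ, l}`. -/
theorem weightedNorm_mul_le_localNorm (ω : WeightFunction) {Ω : Set (Space d)} {l : ℝ}
    (hl : 0 < l) {ψ f : Space d → ℂ} (hψ : ψ ∈ testSpace ω Ω) (hf : f ∈ ultraSpace ω Ω) :
    weightedNorm ω l (ψ * f) ≤ (weightedNorm ω l ψ + 1) * localNorm ω Ω (tsupport ψ) l f := by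
  have hi {φ : Space d → ℂ} (hφ : φ ∈ testSpace ω Ω) : Integrable φ :=
    let h := mem_testSpace.1 hφ l hl
    h.1.integrable_of_hasCompactSupport h.2.1
  have hψl := mem_testSpace.1 hψ l hl
  have ht : weightedNorm ω l ψ + 1 ≠ ⊤ := (ENNReal.add_lt_top.2 ⟨hψl.2.2.2, by simp⟩).ne
  unfold localNorm
  -- The `+ 1` makes the factor nonzero, so that it can be moved inside the infimum.
  simp_rw [ENNReal.mul_iInf_of_ne (by simp : weightedNorm ω l ψ + 1 ≠ 0) ht]
  refine le_iInf₂ fun φ hφ => ?_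
  have he : ψ * f = ψ * (φ * f) := by
    ext x
    by_cases hx : x ∈ tsupport ψ
    · simp [hφ.2 x hx]
    · simp [image_eq_zero_of_notMem_tsupport hx]
  have hφf := hf.2 φ hφ.1
  have hφl := mem_testSpace.1 hφf l hl
  have hpi := hi (hf.2 ψ hψ)
  rw [he] at hpi ⊢
  refine (weightedNorm_mul_le ω hl.le hψl.1 hφl.1 (hi hψ) (hi hφf) hpi hψl.2.2.2
    hφl.2.2.2).trans ?_
  gcongr
  exact le_self_add

/-- Low frequencies are controlled by the bound on `𝓕 f`, high frequencies by the norm of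
index `l + 1`. -/
theorem weightedNorm_le_of_fourier_bound (ω : WeightFunction) {l k s R m₀ C τ : ℝ}
    (hl : 0 ≤ l) (hk : 0 ≤ k) (hs : 0 ≤ s) {f : Space d → ℂ}
    (hf : ∀ ξ, ‖𝓕 f ξ‖ ≤
      C * (Real.exp (k * ω ‖ξ‖) * Real.exp (-(((k + l + s) * R + m₀) * τ)))) :
    weightedNorm ω l f ≤
      ENNReal.ofReal (C * Real.exp (-(m₀ * τ))) *
          (∫⁻ ξ : Space d, ENNReal.ofReal (Real.exp (-(s * ω ‖ξ‖)))) +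
        ENNReal.ofReal (Real.exp (-(R * τ))) * weightedNorm ω (l + 1) f := by
  have hC : 0 ≤ C := by
    have h := (norm_nonneg _).trans (hf 0)
    exact nonneg_of_mul_nonneg_left h (by positivity)
  have hm : Measurable fun ξ : Space d => ENNReal.ofReal (Real.exp (-(s * ω ‖ξ‖))) := by
    simpa using (continuous_weight (d := d) ω (-s)).measurable
  rw [weightedNorm, weightedNorm, ← lintegral_const_mul _ hm,
    ← lintegral_const_mul' _ _ ENNReal.ofReal_ne_top, ← lintegral_add_left (hm.const_mul _)]
  refine lintegral_mono fun ξ => ?_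
  -- Low frequencies: `e^{(k+l)ω} = e^{(k+l+s)ω} e^{-sω} ≤ e^{(k+l+s)Rτ} e^{-sω}`, and the first
  -- factor is absorbed by the decay in `hf`. High frequencies: `e^{lω} = e^{-ω} e^{(l+1)ω} ≤
  -- e^{-Rτ} e^{(l+1)ω}`.
  rcases le_total (ω ‖ξ‖) (R * τ) with h | h
  · refine le_trans ?_ le_self_add
    rw [← ofReal_norm, ← ENNReal.ofReal_mul (norm_nonneg _),
      ← ENNReal.ofReal_mul (by positivity)]
    refine ENNReal.ofReal_le_ofReal ((mul_le_mul_of_nonneg_right (hf ξ)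
      (Real.exp_nonneg _)).trans ?_)
    simp only [mul_assoc]
    refine mul_le_mul_of_nonneg_left ?_ hC
    rw [← Real.exp_add, ← Real.exp_add, ← Real.exp_add, Real.exp_le_exp]
    have := mul_le_mul_of_nonneg_left h (by positivity : 0 ≤ k + l + s)
    linarith
  · refine le_trans ?_ le_add_self
    rw [mul_left_comm, ← ENNReal.ofReal_mul (Real.exp_nonneg _), ← Real.exp_add]
    gcongr
    linarith

theorem isLittleOExp_const_mul_exp_neg (ω : WeightFunction) (C : ℝ) {k m : ℝ} (hkm : k < m) :
    IsLittleOExp ω (-k) fun ε =>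
      ENNReal.ofReal (C * Real.exp (-(m * ω (1 / (ε : ℝ))))) := by
  have h1 : Tendsto (fun ε : NetIndex => C * Real.exp (-((m - k) * ω (1 / (ε : ℝ))))) toZero
      (𝓝 0) := by
    simpa using (Real.tendsto_exp_neg_atTop_nhds_zero.comp
      ((tendsto_weight_one_div ω).const_mul_atTop (sub_pos.2 hkm))).const_mul C
  have h2 := ENNReal.tendsto_ofReal h1
  rw [ENNReal.ofReal_zero] at h2
  refine h2.congr fun ε => ?_
  rw [← ENNReal.ofReal_div_of_pos (Real.exp_pos _), mul_div_assoc, ← Real.exp_sub]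
  ring_nf

theorem IsLittleOExp.exp_neg_mul {ω : WeightFunction} {k k' R : ℝ} {u : NetIndex → ℝ≥0∞}
    (hu : IsLittleOExp ω k u) (h : k' = k - R) :
    IsLittleOExp ω k' fun ε => ENNReal.ofReal (Real.exp (-(R * ω (1 / (ε : ℝ))))) * u ε := by
  refine Tendsto.congr (fun ε => ?_) hu
  have hp (r : ℝ) : ENNReal.ofReal (Real.exp r) ≠ 0 := by simp [Real.exp_pos]
  have he : Real.exp (k' * ω (1 / (ε : ℝ))) =
      Real.exp (-(R * ω (1 / (ε : ℝ)))) * Real.exp (k * ω (1 / (ε : ℝ))) := by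
    rw [← Real.exp_add, h]
    ring_nf
  rw [he, ENNReal.ofReal_mul (Real.exp_nonneg _),
    ENNReal.mul_div_mul_left _ _ (hp _) ENNReal.ofReal_ne_top]

theorem IsLittleOExp.of_eventually_le {ω : WeightFunction} {k : ℝ} {u v : NetIndex → ℝ≥0∞}
    (hu : IsLittleOExp ω k u) (hvu : ∀ᶠ ε in toZero, v ε ≤ u ε) : IsLittleOExp ω k v :=
  tendsto_of_tendsto_of_tendsto_of_le_of_le' tendsto_const_nhds hu
    (Eventually.of_forall fun _ => zero_le) (hvu.mono fun _ h => ENNReal.div_le_div_right h _)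

/-! ### Conclusion -/

theorem IsModerate.isNegligible {ω : WeightFunction} {Ω : Set (Space d)}
    {g : NetIndex → ultraSpace ω Ω} (hg : IsModerate ω Ω g) {k : ℝ} (hk : 0 < k)
    (hyp : ∀ ρ ∈ testSpaceAt ω k Ω, IsNegligibleConst ω fun ε => pairing Ω (g ε) ρ) :
    IsNegligible ω Ω g := by
  intro K hK hKΩ l hl m hm
  -- Moderateness provides the cut-off: if there were none, the local norms on `K` would be infima
  -- over the empty set, hence infinite.
  obtain ⟨_, _, hcut⟩ := hg K hK hKΩ l hl
  obtain ⟨ψ, hψ, hψK⟩ := hcut.exists_cutoff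
  obtain ⟨hS, hSΩ⟩ := tsupport_subset hψ
  have hl1 : 0 < l + 1 := by linarith
  obtain ⟨k', hk', hmod⟩ := hg _ hS hSΩ (l + 1) hl1
  obtain ⟨s, hs, hfin⟩ := exists_lintegral_exp_neg_lt_top d ω
  have hi (ε : NetIndex) : Integrable (ψ * (g ε : Space d → ℂ)) :=
    let h := mem_testSpace.1 ((g ε).2.2 ψ hψ) 1 one_pos
    h.1.integrable_of_hasCompactSupport h.2.1
  -- The splitting parameter is `R = k' + m`: the gain `e^{-Rω(1/ε)}` turns the moderate growth of
  -- order `k'` into decay of order `m`. The part `(k + l + s) R` pays for the low frequencies, and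
  -- the remaining `m + 1` exceeds `m`, which yields `o` rather than `O`.
  have hpos : 0 < (k + l + s) * (k' + m) + (m + 1) := by positivity
  have hψk := mem_testSpace.1 hψ k hk
  obtain ⟨C, hC⟩ := exists_fourier_bound ω hk.le hyp hψk hi hpos
  have hψn : weightedNorm ω (l + 1) ψ + 1 ≠ ⊤ :=
    (ENNReal.add_lt_top.2 ⟨(mem_testSpace.1 hψ _ hl1).2.2.2, ENNReal.one_lt_top⟩).ne
  have hlow := (isLittleOExp_const_mul_exp_neg ω C (lt_add_one m)).const_mul hfin.ne
  have hhigh := (hmod.const_mul hψn).exp_neg_mul (R := k' + m) (k' := -m) (by ring)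
  refine (hlow.add hhigh).of_eventually_le (hC.mono fun ε hε => ?_)
  refine (iInf₂_le ψ ⟨hψ, hψK⟩).trans
    ((weightedNorm_le_of_fourier_bound ω hl.le hk.le hs hε).trans ?_)
  rw [mul_comm (ENNReal.ofReal (C * _))]
  gcongr
  exact weightedNorm_mul_le_localNorm ω hl1 hψ (g ε).2

end UltraBeurling

theorem mainTheorem8 {d : ℕ} (ω : UltraBeurling.WeightFunction)
    (Ω : Set (UltraBeurling.Space d)) (hΩ : IsOpen Ω)
    (h : UltraBeurling.GenFun ω Ω)
    (g : UltraBeurling.moderateNets ω Ω) (hg : UltraBeurling.GenFun.mk g = h)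
    (hyp : ∃ k : ℝ, 0 < k ∧ ∀ ρ ∈ UltraBeurling.testSpaceAt ω k Ω,
      UltraBeurling.IsNegligibleConst ω
        fun ε => UltraBeurling.pairing Ω (g.1 ε : UltraBeurling.Space d → ℂ) ρ) :
    h = 0 := by
  obtain ⟨k, hk, hyp⟩ := hyp
  rw [← hg]
  refine (Submodule.Quotient.mk_eq_zero _).2 (Submodule.mem_comap.2 ?_)
  rcases g.2 with hmod | h0
  · exact Or.inl (hmod.isNegligible hk hyp)
  · exact Or.inr h0
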